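/- Let $a,b\in\mathbb C$. Let $CHV(a,b)$ be the Lie conformal algebra that is free over $\mathbb C[\partial]$ with basis $\{L_i,M_i\mid i\in\mathbb Z\}$ and whose $\lambda$-brackets are determined by $$[L_i\,{}_\lambda L_j]=(\partial+2\lambda)L_{i+j},\qquad [L_i\,{}_\lambda M_j]=(\partial+a\lambda+b)M_{i+j},\qquad [M_i\,{}_\lambda M_j]=0,$$ sesquilinearity and skew-symmetry. It is $\mathbb Z$-graded with $CHV(a,b)_i=\mathbb C[\partial]L_i\oplus\mathbb C[\partial]M_i$. A conformal module $V$ over $CHV(a,b)$ is a $\mathbb Z$-graded free intermediate series module if $V=\bigoplus_{i\in\mathbb Z}V_i$ with $\mathbb C[\partial]$-submodules $V_i$, each freely generated over $\mathbb C[\partial]$ by one element, and $(CHV(a,b)_i)_\lambda V_j\subset V_{i+j}[\lambda]$ for all $i,j$. It is nontrivial if the $\lambda$-action is not identically zero. On the free $\mathbb C[\partial]$-module $\bigoplus_{m\in\mathbb Z}\mathbb C[\partial]v_m$ consider, for $\alpha,\beta,d\in\mathbb C$ and $A=(a_m)_{m\in\mathbb Z}\in\{0,1\}^{\mathbb Z}$,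 the following $\lambda$-actions (extended by sesquilinearity): * $V'_{\alpha,\beta,d}$: $\ L_i\,{}_\lambda v_m=(\partial+\alpha\lambda+\beta)v_{i+m}$, $\ M_i\,{}_\lambda v_m=d\,v_{i+m}$; * $V'_{A,\beta,d}$: $\ M_i\,{}_\lambda v_m=d\,v_{i+m}$ and $L_i\,{}_\lambda v_m$ equals $(\partial+\beta)v_{i+m}$, $(\partial+\beta+\lambda)v_{i+m}$, $v_{i+m}$ or $(\partial+\beta)(\partial+\beta+\lambda)v_{i+m}$ according as $(a_m,a_{i+m})$ is $(0,0)$, $(1,1)$, $(0,1)$ or $(1,0)$. Put $V'_{\alpha,\beta}=V'_{\alpha,\beta,0}$ and $V'_{A,\beta}=V'_{A,\beta,0}$, so that all $M_i$ act trivially on these. Let $V$ be a nontrivial $\mathbb Z$-graded free intermediate series module over $CHV(a,b)$. Then, with $\cong$ meaning a $\mathbb C[\partial]$-linear bijection that respects the $\lambda$-actions and maps $V_m$ onto $\mathbb C[\partial]v_m$ for every $m$: 1. If $a\neq 1$ or $b\neq 0$, then $V\cong V'_{\alpha,\beta}$ for some $\alpha,\beta\in\mathbb C$, or $V\cong V'_{A,\beta}$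 for some $A\in\{0,1\}^{\mathbb Z}$ and $\beta\in\mathbb C$. 2. If $a=1$ and $b=0$, then $V\cong V'_{\alpha,\beta,d}$ for some $\alpha,\beta,d\in\mathbb C$, or $V\cong V'_{A,\beta,d}$ for some $A\in\{0,1\}^{\mathbb Z}$ and $\beta,d\in\mathbb C$. -/

import Mathlib

open Polynomial

noncomputable section

/-- `M[λ] = ℂ[λ] ⊗ M` for a `ℂ[∂]`-module `M`. Throughout, `ℂ[X]` is `ℂ[∂]`, and `ℂ[X][X]` is
`ℂ[∂][λ]`: the inner variable `C X` is `∂`, the outer variable `X` is `λ`. It acts on `M[λ]`. -/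
abbrev LamPoly (M : Type*) [AddCommGroup M] [Module ℂ[X] M] := PolynomialModule ℂ[X] M

/-- The value in `M` of an element of `M[λ]` at `λ = z` for a number `z`. An element of `M[λ]` is
determined by these values, so identities between polynomials in `λ` (and `μ`) are stated
below for all complex values of `λ` (and `μ`). -/
abbrev atLam {M : Type*} [AddCommGroup M] [Module ℂ[X] M] (z : ℂ) (P : LamPoly M) : M :=
  PolynomialModule.eval (C z) P

/-- A Lie conformal algebra structure on a `ℂ[∂]`-module `R`: a `ℂ`-bilinear `λ`-bracket
`[a _λ b] ∈ R[λ]` with conformal sesquilinearity, skew-symmetry and the Jacobi identity. -/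
structure LieConformalAlgebra (R : Type*) [AddCommGroup R] [Module ℂ R] [Module ℂ[X] R]
    [IsScalarTower ℂ ℂ[X] R] where
  /-- the `λ`-bracket `[a _λ b]` -/
  br : R →ₗ[ℂ] R →ₗ[ℂ] LamPoly R
  /-- `[∂a _λ b] = -λ [a _λ b]` -/
  br_left : ∀ a b : R, br ((X : ℂ[X]) • a) b = (-X : ℂ[X][X]) • br a b
  /-- `[a _λ ∂b] = (∂ + λ) [a _λ b]` -/
  br_right : ∀ a b : R, br a ((X : ℂ[X]) • b) = (C X + X : ℂ[X][X]) • br a b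
  /-- `[a _λ b] = -[b _{-λ-∂} a]`, where `-λ-∂` is substituted with `∂` acting on the
  coefficients of `[b _μ a]` -/
  br_skew : ∀ (a b : R) (l : ℂ), atLam l (br a b) = -PolynomialModule.eval (-C l - X) (br b a)
  /-- `[a _λ [b _μ c]] = [[a _λ b] _{λ+μ} c] + [b _μ [a _λ c]]` -/
  br_jacobi : ∀ (a b c : R) (l m : ℂ),
    atLam l (br a (atLam m (br b c))) =
      atLam (l + m) (br (atLam l (br a b)) c) + atLam m (br b (atLam l (br a c)))

section ConformalModules

variable {R : Type*} [AddCommGroup R] [Module ℂ R] [Module ℂ[X] R] [IsScalarTower ℂ ℂ[X] R]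
variable {V : Type*} [AddCommGroup V] [Module ℂ V] [Module ℂ[X] V] [IsScalarTower ℂ ℂ[X] V]
variable {W : Type*} [AddCommGroup W] [Module ℂ W] [Module ℂ[X] W] [IsScalarTower ℂ ℂ[X] W]

/-- The `λ`-action `act : R ⊗ V → V[λ]`, `a ⊗ v ↦ a _λ v`, makes the `ℂ[∂]`-module `V` a conformal
module over the Lie conformal algebra `A` on `R`. -/
structure IsConformalModule (A : LieConformalAlgebra R) (act : R →ₗ[ℂ] V →ₗ[ℂ] LamPoly V) :
    Prop where
  /-- `(∂a) _λ v = -λ (a _λ v)` -/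
  act_left : ∀ (a : R) (v : V), act ((X : ℂ[X]) • a) v = (-X : ℂ[X][X]) • act a v
  /-- `a _λ (∂v) = (∂ + λ) (a _λ v)` -/
  act_right : ∀ (a : R) (v : V), act a ((X : ℂ[X]) • v) = (C X + X : ℂ[X][X]) • act a v
  /-- `a _λ (b _μ v) - b _μ (a _λ v) = [a _λ b] _{λ+μ} v` -/
  act_br : ∀ (a b : R) (v : V) (l m : ℂ),
    atLam l (act a (atLam m (act b v))) - atLam m (act b (atLam l (act a v))) =
      atLam (l + m) (act (atLam l (A.br a b)) v)

/-- `V = ⊕ Vᵢ` is a decomposition into `ℂ[∂]`-submodules that makes a module over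
`R = ⊕ Rᵢ` a `ℤ`-graded one, `(Rᵢ) _λ (Vⱼ) ⊆ V_{i+j}[λ]`, and each `Vᵢ` is freely
generated by one element over `ℂ[∂]`. -/
structure IsFreeIntermediateSeries (grR : ℤ → Submodule ℂ[X] R)
    (act : R →ₗ[ℂ] V →ₗ[ℂ] LamPoly V) (grV : ℤ → Submodule ℂ[X] V) : Prop where
  isInternal : DirectSum.IsInternal grV
  act_mem : ∀ (i j : ℤ), ∀ a ∈ grR i, ∀ v ∈ grV j, ∀ n : ℕ, (act a v).coeff n ∈ grV (i + j)
  free : ∀ i : ℤ, ∃ v : V, grV i = Submodule.span ℂ[X] {v} ∧ ∀ p : ℂ[X], p • v = 0 → p = 0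

/-- `V` and `W`, with `λ`-actions of `R` and gradings, are isomorphic: there is a `ℂ[∂]`-linear
bijection `φ` with `a _λ φ(v) = φ(a _λ v)` and `φ(Vₘ) = Wₘ`. -/
def GradedIsomorphic (actV : R →ₗ[ℂ] V →ₗ[ℂ] LamPoly V) (grV : ℤ → Submodule ℂ[X] V)
    (actW : R →ₗ[ℂ] W →ₗ[ℂ] LamPoly W) (grW : ℤ → Submodule ℂ[X] W) : Prop :=
  ∃ φ : V ≃ₗ[ℂ[X]] W,
    (∀ (a : R) (v : V),
      actW a (φ v) = PolynomialModule.map ℂ[X] (φ : V →ₗ[ℂ[X]] W) (actV a v)) ∧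
    ∀ m : ℤ, (grV m).map (φ : V →ₗ[ℂ[X]] W) = grW m

end ConformalModules

section Sesquilinear

variable {ι κ : Type*}

/-- The `ℂ`-bilinear map on free `ℂ[∂]`-modules with bases `ι`, `κ` that is given on the bases by
`K` and satisfies `p(∂)x _λ q(∂)y = p(-λ) q(∂+λ) (x _λ y)`. -/
def sesqExtend (K : ι → κ → LamPoly (κ →₀ ℂ[X])) :
    (ι →₀ ℂ[X]) →ₗ[ℂ] (κ →₀ ℂ[X]) →ₗ[ℂ] LamPoly (κ →₀ ℂ[X]) :=
  LinearMap.mk₂ ℂ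
    (fun f g => f.sum fun x p => g.sum fun y q =>
      (aeval (-X : ℂ[X][X]) p * aeval (C X + X : ℂ[X][X]) q) • K x y)
    (by
      intro f f' g
      refine Finsupp.sum_add_index' (by simp) ?_
      intro x p p'
      simp only [map_add, add_mul, add_smul]
      exact Finsupp.sum_add)
    (by
      intro c f g
      rw [Finsupp.sum_smul_index' (by simp), Finsupp.smul_sum]
      refine Finsupp.sum_congr fun x _ => ?_
      rw [Finsupp.smul_sum]
      refine Finsupp.sum_congr fun y _ => ?_
      rw [map_smul, smul_mul_assoc, smul_assoc])
    (by
      intro f g g'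
      rw [← Finsupp.sum_add]
      refine Finsupp.sum_congr fun x _ => ?_
      refine Finsupp.sum_add_index' (by simp) ?_
      intro y q q'
      simp only [map_add, mul_add, add_smul])
    (by
      intro c f g
      rw [Finsupp.smul_sum]
      refine Finsupp.sum_congr fun x _ => ?_
      rw [Finsupp.sum_smul_index' (by simp), Finsupp.smul_sum]
      refine Finsupp.sum_congr fun y _ => ?_
      rw [map_smul, mul_smul_comm, smul_assoc])

end Sesquilinear

section CHV

/-- The `ℂ[∂]`-basis `{Lᵢ, Mᵢ | i ∈ ℤ}` of `CHV(a,b)`. -/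
inductive CHVGen : Type
  | L (i : ℤ)
  | M (i : ℤ)

/-- The free `ℂ[∂]`-module `(⊕ᵢ ℂ[∂]Lᵢ) ⊕ (⊕ᵢ ℂ[∂]Mᵢ)` underlying `CHV(a,b)`. -/
abbrev CHVCarrier : Type := CHVGen →₀ ℂ[X]

/-- The `λ`-brackets of the basis elements: `[Lᵢ _λ Lⱼ] = (∂+2λ)L_{i+j}`,
`[Lᵢ _λ Mⱼ] = (∂+aλ+b)M_{i+j}`, `[Mᵢ _λ Mⱼ] = 0`, and `[Mᵢ _λ Lⱼ]` is what skew-symmetry makes of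
`[Lⱼ _λ Mᵢ]`, namely `-(∂+a(-λ-∂)+b)M_{i+j}`. -/
def chvBasisBracket (a b : ℂ) : CHVGen → CHVGen → LamPoly CHVCarrier
  | .L i, .L j => (C X + 2 * X : ℂ[X][X]) •
      PolynomialModule.single ℂ[X] 0 (Finsupp.single (.L (i + j)) 1)
  | .L i, .M j => (C X + C (C a) * X + C (C b) : ℂ[X][X]) •
      PolynomialModule.single ℂ[X] 0 (Finsupp.single (.M (i + j)) 1)
  | .M i, .L j => (-(C X + C (C a) * (-X - C X) + C (C b)) : ℂ[X][X]) •
      PolynomialModule.single ℂ[X] 0 (Finsupp.single (.M (i + j)) 1)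
  | .M _, .M _ => 0

theorem sesqExtend_single {ι κ : Type*} (K : ι → κ → LamPoly (κ →₀ ℂ[X])) (x : ι) (y : κ)
    (p q : ℂ[X]) :
    sesqExtend K (Finsupp.single x p) (Finsupp.single y q) =
      (aeval (-X : ℂ[X][X]) p * aeval (C X + X : ℂ[X][X]) q) • K x y := by
  simp [sesqExtend]

theorem sesqExtend_left {ι κ : Type*} (K : ι → κ → LamPoly (κ →₀ ℂ[X])) (f : ι →₀ ℂ[X])
    (g : κ →₀ ℂ[X]) :
    sesqExtend K ((X : ℂ[X]) • f) g = (-X : ℂ[X][X]) • sesqExtend K f g := by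
  induction f using Finsupp.induction_linear with
  | zero => simp
  | add f f' h h' => simp only [smul_add, map_add, LinearMap.add_apply, h, h']
  | single x p =>
    induction g using Finsupp.induction_linear with
    | zero => simp
    | add g g' h h' => simp only [smul_add, map_add, h, h']
    | single y q =>
      rw [Finsupp.smul_single, sesqExtend_single, sesqExtend_single, smul_smul]
      congr 1
      simp only [smul_eq_mul, map_mul, aeval_X]
      ring

theorem sesqExtend_right {ι κ : Type*} (K : ι → κ → LamPoly (κ →₀ ℂ[X])) (f : ι →₀ ℂ[X])
    (g : κ →₀ ℂ[X]) :
    sesqExtend K f ((X : ℂ[X]) • g) = (C X + X : ℂ[X][X]) • sesqExtend K f g := by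
  induction f using Finsupp.induction_linear with
  | zero => simp
  | add f f' h h' => simp only [smul_add, map_add, LinearMap.add_apply, h, h']
  | single x p =>
    induction g using Finsupp.induction_linear with
    | zero => simp
    | add g g' h h' => simp only [smul_add, map_add, h, h']
    | single y q =>
      rw [Finsupp.smul_single, sesqExtend_single, sesqExtend_single, smul_smul]
      congr 1
      simp only [smul_eq_mul, map_mul, aeval_X]
      ring

/-- A property of elements of a free `ℂ[∂]`-module holds if it holds on the basis and is stable
under sums, complex multiples and `∂`. -/
theorem free_induction {ι : Type*} {P : (ι →₀ ℂ[X]) → Prop} (h0 : P 0)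
    (hadd : ∀ f g, P f → P g → P (f + g)) (hsmul : ∀ (c : ℂ) f, P f → P (c • f))
    (hX : ∀ f, P f → P ((X : ℂ[X]) • f)) (hs : ∀ x, P (Finsupp.single x 1)) (f : ι →₀ ℂ[X]) :
    P f := by
  induction f using Finsupp.induction_linear with
  | zero => exact h0
  | add f g hf hg => exact hadd f g hf hg
  | single x p =>
    induction p using Polynomial.induction_on with
    | C c =>
      have := hsmul c _ (hs x)
      rwa [Finsupp.smul_single, Polynomial.smul_eq_C_mul, mul_one] at this
    | add p q hp hq => rw [Finsupp.single_add]; exact hadd _ _ hp hq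
    | monomial n c h =>
      have := hX _ h
      rwa [Finsupp.smul_single, smul_eq_mul, show (X : ℂ[X]) * (C c * X ^ n) = C c * X ^ (n + 1) by
        ring] at this

theorem C_smul_eq {M : Type*} [AddCommGroup M] [Module ℂ M] [Module ℂ[X] M]
    [IsScalarTower ℂ ℂ[X] M] (c : ℂ) (v : M) : (C c : ℂ[X]) • v = c • v := by
  rw [← algebraMap_smul ℂ[X] c v]; rfl

theorem eval_complex_smul {M : Type*} [AddCommGroup M] [Module ℂ M] [Module ℂ[X] M]
    [IsScalarTower ℂ ℂ[X] M] (r : ℂ[X]) (c : ℂ) (P : LamPoly M) :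
    PolynomialModule.eval r (c • P) = c • PolynomialModule.eval r P := by
  rw [← algebraMap_smul ℂ[X] c P, map_smul, algebraMap_smul]

/-- Skew-symmetry of a sesquilinear bracket follows from skew-symmetry on a basis. -/
theorem skew_of_basis {ι : Type*} (K : ι → ι → LamPoly (ι →₀ ℂ[X])) (l : ℂ)
    (hK : ∀ x y, atLam l (K x y) = -PolynomialModule.eval (-C l - X) (K y x))
    (f g : ι →₀ ℂ[X]) :
    atLam l (sesqExtend K f g) = -PolynomialModule.eval (-C l - X) (sesqExtend K g f) := by
  induction f using Finsupp.induction_linear with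
  | zero => simp
  | add f f' h h' => simp only [map_add, LinearMap.add_apply, h, h', neg_add]
  | single x p =>
    induction g using Finsupp.induction_linear with
    | zero => simp
    | add g g' h h' => simp only [map_add, LinearMap.add_apply, h, h', neg_add]
    | single y q =>
      have h1 : ∀ (r s : ℂ[X]), eval s (aeval (-X : ℂ[X][X]) r) = aeval (-s) r := by
        intro r s
        induction r using Polynomial.induction_on' with
        | add r r' h h' => simp [h, h']
        | monomial n c => simp [aeval_monomial]
      have h2 : ∀ (r s : ℂ[X]), eval s (aeval (C X + X : ℂ[X][X]) r) = aeval (X + s) r := by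
        intro r s
        induction r using Polynomial.induction_on' with
        | add r r' h h' => simp [h, h']
        | monomial n c => simp [aeval_monomial]
      rw [sesqExtend_single, sesqExtend_single, atLam, PolynomialModule.eval_smul,
        PolynomialModule.eval_smul, ← smul_neg, ← hK x y, eval_mul, eval_mul, h1, h1, h2, h2,
        show -(-C l - X : ℂ[X]) = X + C l by ring, show X + (-C l - X : ℂ[X]) = -C l by ring,
        mul_comm]

/-- The Jacobi identity for a sesquilinear family of brackets follows from the Jacobi identity on
a basis. -/
theorem jacobi_of_basis {ι : Type*}
    (B : ℂ → (ι →₀ ℂ[X]) →ₗ[ℂ] (ι →₀ ℂ[X]) →ₗ[ℂ] (ι →₀ ℂ[X]))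
    (hl : ∀ z f g, B z ((X : ℂ[X]) • f) g = -(z • B z f g))
    (hr : ∀ z f g, B z f ((X : ℂ[X]) • g) = (X : ℂ[X]) • B z f g + z • B z f g)
    (l m : ℂ)
    (hB : ∀ x y z : ι, B l (Finsupp.single x 1) (B m (Finsupp.single y 1) (Finsupp.single z 1)) =
      B (l + m) (B l (Finsupp.single x 1) (Finsupp.single y 1)) (Finsupp.single z 1) +
        B m (Finsupp.single y 1) (B l (Finsupp.single x 1) (Finsupp.single z 1)))
    (f g h : ι →₀ ℂ[X]) :
    B l f (B m g h) = B (l + m) (B l f g) h + B m g (B l f h) := by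
  induction f using free_induction with
  | h0 => simp
  | hadd f f' h h' => simp only [map_add, LinearMap.add_apply, h, h']; abel
  | hsmul c f h => simp only [map_smul, LinearMap.smul_apply, h, smul_add]
  | hX f h =>
    simp only [hl, map_neg, map_smul, LinearMap.neg_apply, LinearMap.smul_apply, h]
    module
  | hs x =>
    induction g using free_induction with
    | h0 => simp
    | hadd f f' h h' => simp only [map_add, LinearMap.add_apply, h, h']; abel
    | hsmul c f h => simp only [map_smul, LinearMap.smul_apply, h, smul_add]
    | hX f h =>
      simp only [hl, hr, map_neg, map_add, map_smul, LinearMap.add_apply,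
        LinearMap.smul_apply, h]
      module
    | hs y =>
      induction h using free_induction with
      | h0 => simp
      | hadd f f' h h' => simp only [map_add, h, h']; abel
      | hsmul c f h => simp only [map_smul, h, smul_add]
      | hX f h =>
        simp only [hr, map_add, map_smul, h, smul_add]
        module
      | hs z => exact hB x y z

theorem eval_sesq_single {ι κ : Type*} (K : ι → κ → LamPoly (κ →₀ ℂ[X])) (z : ℂ) (x : ι) (y : κ)
    (p q : ℂ[X]) :
    atLam z (sesqExtend K (Finsupp.single x p) (Finsupp.single y q)) =
      (aeval (C (-z) : ℂ[X]) p * aeval (X + C z : ℂ[X]) q) • atLam z (K x y) := by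
  rw [sesqExtend_single, atLam, PolynomialModule.eval_smul, eval_mul]
  congr 2
  · induction p using Polynomial.induction_on' with
    | add r r' h h' => simp [h, h']
    | monomial n c => simp [aeval_monomial]
  · induction q using Polynomial.induction_on' with
    | add r r' h h' => simp [h, h']
    | monomial n c => simp [aeval_monomial]

/-- The Lie conformal algebra `CHV(a,b)`. -/
def CHV (a b : ℂ) : LieConformalAlgebra CHVCarrier where
  br := sesqExtend (chvBasisBracket a b)
  br_left := sesqExtend_left _
  br_right := sesqExtend_right _
  br_skew := by
    intro f g l
    refine skew_of_basis _ l ?_ f g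
    intro x y
    cases x <;> cases y <;>
      simp only [chvBasisBracket, PolynomialModule.eval_smul,
        PolynomialModule.eval_single, pow_zero, map_zero, neg_zero]
    all_goals
      rename_i i j
      rw [add_comm j i, ← neg_smul]
      congr 1
      simp
      try ring
  br_jacobi := by
    intro f g h l m
    refine jacobi_of_basis
      (fun z => LinearMap.mk₂ ℂ (fun f g => atLam z (sesqExtend (chvBasisBracket a b) f g))
        (by intros; simp) (by intros; simp only [map_smul, LinearMap.smul_apply, eval_complex_smul])
        (by intros; simp) (by intros; simp only [map_smul, eval_complex_smul]))
      ?_ ?_ l m ?_ f g h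
    · intro z f g
      rw [LinearMap.mk₂_apply, LinearMap.mk₂_apply, sesqExtend_left, atLam,
        PolynomialModule.eval_smul, eval_neg, eval_X, neg_smul, C_smul_eq]
    · intro z f g
      rw [LinearMap.mk₂_apply, LinearMap.mk₂_apply, sesqExtend_right, atLam,
        PolynomialModule.eval_smul, eval_add, eval_X, eval_C, add_smul, C_smul_eq]
    · intro x y z
      have hsingle : ∀ (w : ℂ) (P : ℂ[X][X]) (u : CHVGen),
          atLam w (P • PolynomialModule.single ℂ[X] 0 (Finsupp.single u (1 : ℂ[X]))) =
            Finsupp.single u (P.eval (C w)) := by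
        intro w P u
        rw [atLam, PolynomialModule.eval_smul, PolynomialModule.eval_single, pow_zero, one_smul,
          Finsupp.smul_single, smul_eq_mul, mul_one]
      have h0 : ∀ w : ℂ, atLam w (0 : LamPoly CHVCarrier) = 0 := fun w => map_zero _
      have h2 : ∀ s : ℂ[X], aeval s (2 : ℂ[X]) = 2 := fun s => map_ofNat _ 2
      simp only [LinearMap.mk₂_apply]
      cases x <;> cases y <;> cases z <;>
        simp only [chvBasisBracket, eval_sesq_single, hsingle, h0, map_zero, smul_zero, add_zero,
          LinearMap.zero_apply, Finsupp.smul_single, smul_eq_mul, map_one, one_mul,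
          mul_one]
      all_goals
        rename_i i j k
        rw [add_assoc i j k, add_left_comm j i k]
        simp only [← Finsupp.single_add]
        congr 1
        simp [Polynomial.algebraMap_eq, h2]
        try ring

/-- The homogeneous component `CHV(a,b)ᵢ = ℂ[∂]Lᵢ ⊕ ℂ[∂]Mᵢ`. -/
def chvGrading (i : ℤ) : Submodule ℂ[X] CHVCarrier :=
  Submodule.span ℂ[X] {Finsupp.single (.L i) 1, Finsupp.single (.M i) 1}

end CHV

section Models

/-- The free `ℂ[∂]`-module `⊕ₘ ℂ[∂]vₘ`. -/
abbrev SeriesCarrier : Type := ℤ →₀ ℂ[X]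

/-- The grading of `⊕ₘ ℂ[∂]vₘ` with `m`-th component `ℂ[∂]vₘ`. -/
def seriesGrading (m : ℤ) : Submodule ℂ[X] SeriesCarrier :=
  Submodule.span ℂ[X] {Finsupp.single m 1}

/-- The `λ`-action of the `ℂ[∂]`-module `CHV(a,b)` on `⊕ₘ ℂ[∂]vₘ` that satisfies
`Lᵢ _λ vₘ = f i m (∂,λ) v_{i+m}` and `Mᵢ _λ vₘ = d v_{i+m}` and is extended by sesquilinearity. -/
def seriesAct (f : ℤ → ℤ → ℂ[X][X]) (d : ℂ) :
    CHVCarrier →ₗ[ℂ] SeriesCarrier →ₗ[ℂ] LamPoly SeriesCarrier :=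
  sesqExtend fun x m => match x with
    | .L i => f i m • PolynomialModule.single ℂ[X] 0 (Finsupp.single (i + m) 1)
    | .M i => (C (C d) : ℂ[X][X]) • PolynomialModule.single ℂ[X] 0 (Finsupp.single (i + m) 1)

/-- The `λ`-action of `V'_{α,β,d}`: `Lᵢ _λ vₘ = (∂+αλ+β) v_{i+m}` and `Mᵢ _λ vₘ = d v_{i+m}`.
The module `V'_{α,β}`, on which all `Mᵢ` act by `0`, is the case `d = 0`. -/
def firstAct (α β d : ℂ) : CHVCarrier →ₗ[ℂ] SeriesCarrier →ₗ[ℂ] LamPoly SeriesCarrier :=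
  seriesAct (fun _ _ => C X + C (C α) * X + C (C β)) d

/-- The coefficients of the `Lᵢ` on `V_{A,β}`, for a sequence `A = (aₘ)` in `{0,1}`. -/
def secondCoeff (A : ℤ → Fin 2) (β : ℂ) (i m : ℤ) : ℂ[X][X] :=
  match A m, A (i + m) with
  | 0, 0 => C X + C (C β)
  | 1, 1 => C X + C (C β) + X
  | 0, 1 => 1
  | 1, 0 => (C X + C (C β)) * (C X + C (C β) + X)

/-- The `λ`-action of `V'_{A,β,d}`: `Lᵢ _λ vₘ` is `v_{i+m}` times `∂+β`, `∂+β+λ`, `1` or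
`(∂+β)(∂+β+λ)` if `(aₘ, a_{i+m})` is `(0,0)`, `(1,1)`, `(0,1)` or `(1,0)`, and
`Mᵢ _λ vₘ = d v_{i+m}`. The module `V'_{A,β}`, on which all `Mᵢ` act by `0`, is the case `d = 0`. -/
def secondAct (A : ℤ → Fin 2) (β d : ℂ) :
    CHVCarrier →ₗ[ℂ] SeriesCarrier →ₗ[ℂ] LamPoly SeriesCarrier :=
  seriesAct (secondCoeff A β) d

end Models

end

/-! A free generator of each `V_m` turns the module into families of polynomials `f i m` and `g i m`
in `∂, λ`, the coefficients of `L_i` and `M_i`. The module identity becomes functional equations for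
their values, in which a factor `∂` of a bracket turns into `-(λ+μ)`.

The action of `L_0` on `V_m` is a rank one Virasoro action; a degree count in `λ`
(`virasoro_rank_one`) forces it to be `∂ + α_m λ + β_m`. The relation of `L_i` with `L_0` makes `f i
m` an intertwiner from weight `α_m` to weight `α_{i+m}`. Up to a scalar there are only three kinds
(`intertwiner`): a constant raising the weight by one, `∂ + αλ + β` keeping it, and a quadratic
polynomial from weight 1 to weight 0; moreover all `β_m` agree. All `f i m` being nonzero, either
the weights are all equal or they take exactly the values 0 and 1. The remaining scalars satisfy a
cocycle identity and are absorbed into the generators (`exists_rescaling`).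

For the `M_i`, the relation `[M_0, M_0] = 0` removes `∂` from `g 0 m`, and `[L_0, M_0]` makes it a
constant, which is zero unless `a = 1` and `b = 0`. Then `[L_i, M_0]` gives `g i m` as `d` times the
difference quotient of `f i m (·, 0)`. This is `d` itself when the weights are constant. When both
weights 0 and 1 occur, one more bracket forces `d = 0`, so the second family is only needed with
trivial `M_i`; a constant sequence `A` is already covered by the first family. -/

/-! ### Polynomials in `∂` and `λ` through their values -/

theorem evalEval_ext {f g : ℂ[X][X]} (h : ∀ x l : ℂ, evalEval x l f = evalEval x l g) : f = g := by
  have hC : ∀ l : ℂ, f.eval (C l) = g.eval (C l) := fun l => Polynomial.funext fun x => h x l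
  have := Polynomial.eq_of_infinite_eval_eq f g
  refine this (Set.Infinite.mono ?_ (Set.infinite_range_of_injective (C_injective (R := ℂ))))
  rintro _ ⟨l, rfl⟩
  exact hC l

theorem exists_evalEval_ne_zero {f : ℂ[X][X]} (hf : f ≠ 0) : ∃ x l : ℂ, evalEval x l f ≠ 0 := by
  by_contra! h
  exact hf (evalEval_ext fun x l => by simpa using h x l)

theorem eval_map_evalRingHom_eq (f : ℂ[X][X]) (x l : ℂ) :
    (f.map (evalRingHom x)).eval l = evalEval x l f := by
  rw [evalEval, ← coe_evalRingHom, ← coe_evalRingHom]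
  induction f using Polynomial.induction_on' with
  | add p q hp hq => simp_all
  | monomial n c => simp

/-- If the values of `f`, `g` have zero product along the diagonal `(x + l, l)`, `(x, l)`, then one
of them vanishes. -/
theorem eq_zero_or_of_diag {f g : ℂ[X][X]}
    (h : ∀ x l : ℂ, evalEval (x + l) l f * evalEval x l g = 0) : f = 0 ∨ g = 0 := by
  by_contra! hfg
  have key : ∀ l : ℂ, ((f.eval (C l)).comp (X + C l)) * g.eval (C l) = 0 := fun l =>
    Polynomial.funext fun x => by simpa [evalEval] using h x l
  -- For each fixed `l`, one of `f(·, l)` and `g(·, l)` is the zero polynomial, whatever shift was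
  -- applied, so the unshifted product vanishes as well.
  have key2 : ∀ l : ℂ, (f * g).eval (C l) = 0 := by
    intro l
    rcases mul_eq_zero.1 (key l) with h1 | h1
    · have : f.eval (C l) = 0 := by
        have := congrArg (fun p => p.comp (X - C l)) h1
        simpa [comp_assoc] using this
      simp [this]
    · simp [h1]
  have : f * g = 0 := evalEval_ext fun x l => by rw [evalEval, key2]; simp
  simp_all

/-- There is a point `x` at which the degree in `λ` of `f(x, λ)` is the full one. -/
theorem exists_natDegree_map_eq {f : ℂ[X][X]} (hf : f ≠ 0) :
    ∃ x : ℂ, (f.map (evalRingHom x)).natDegree = f.natDegree ∧ f.map (evalRingHom x) ≠ 0 := by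
  have hl : f.leadingCoeff ≠ 0 := leadingCoeff_ne_zero.2 hf
  obtain ⟨x, hx⟩ : ∃ x : ℂ, f.leadingCoeff.eval x ≠ 0 := by
    by_contra! h
    exact hl (Polynomial.funext fun x => by simpa using h x)
  refine ⟨x, natDegree_map_of_leadingCoeff_ne_zero _ (by simpa using hx), fun h => hx ?_⟩
  have := congrArg (fun p => p.coeff f.natDegree) h
  simpa using this

/-! ### Rank one Virasoro actions and commuting actions -/

/-- Putting `l = 2m` gives `p(3m) = 2p(2m) - p(m)`. On the coefficient of degree `n` this reads `3^n
+ 1 = 2·2^n`, which fails for every `n ≥ 2`. -/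
theorem linear_of_functional_eq (p : ℂ[X])
    (h : ∀ l m : ℂ, l * p.eval l - m * p.eval m = (l - m) * p.eval (l + m)) :
    ∃ α β : ℂ, ∀ l, p.eval l = α * l + β := by
  have h1 : X * (p.comp (C 3 * X)) = X * (C 2 * p.comp (C 2 * X) - p) := by
    refine Polynomial.funext fun m => ?_
    have := h (2 * m) m
    rw [show 2 * m + m = 3 * m by ring] at this
    simp only [eval_mul, eval_X, eval_comp, eval_C, eval_sub]
    linear_combination -this
  have h2 := mul_left_cancel₀ X_ne_zero h1
  have h3 : p.natDegree ≤ 1 := by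
    refine natDegree_le_iff_coeff_eq_zero.2 fun n hn => ?_
    have h4 := congrArg (fun q => q.coeff n) h2
    simp only [comp_C_mul_X_coeff, coeff_sub, coeff_C_mul] at h4
    have h5 : p.coeff n * ((3 : ℂ) ^ n - 2 * 2 ^ n + 1) = 0 := by linear_combination h4
    refine (mul_eq_zero.1 h5).resolve_right fun h6 => ?_
    have h7 : (3 : ℕ) ^ n + 1 = 2 * 2 ^ n := by
      have : ((3 : ℂ) ^ n + 1) = 2 * 2 ^ n := by linear_combination h6
      exact_mod_cast this
    obtain ⟨k, rfl⟩ := Nat.exists_eq_add_of_lt hn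
    have h8 : (2 : ℕ) ^ k ≤ 3 ^ k := Nat.pow_le_pow_left (by norm_num) k
    have h9 : (3 : ℕ) ^ (1 + k + 1) = 9 * 3 ^ k := by ring
    have h10 : (2 : ℕ) ^ (1 + k + 1) = 4 * 2 ^ k := by ring
    omega
  obtain ⟨α, β, rfl⟩ := exists_eq_X_add_C_of_natDegree_le_one h3
  exact ⟨α, β, fun l => by simp⟩

/-- The rank one modules over the Virasoro conformal algebra. -/
theorem virasoro_rank_one {f : ℂ[X][X]} (hf : f ≠ 0)
    (h : ∀ x l m : ℂ, evalEval (x + l) m f * evalEval x l f -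
      evalEval (x + m) l f * evalEval x m f = (l - m) * evalEval x (l + m) f) :
    ∃ α β : ℂ, ∀ x l, evalEval x l f = x + α * l + β := by
  obtain ⟨x, hx, hx0⟩ := exists_natDegree_map_eq hf
  set Q := f.map (evalRingHom x) with hQ
  have hlin : ∀ y m : ℂ, evalEval y m f = y - x + evalEval x m f := by
    intro y m
    set P := (f.eval (C m)).comp (X + C x) with hP
    set S := C (evalEval x m f) * f.map (evalRingHom (x + m)) with hS
    -- The relation is read as a polynomial identity in `l`, with `x` and `m` fixed. The right side
    -- has degree at most `deg_λ f + 1` and `Q` has the full degree `deg_λ f`, so `P` has degree at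
    -- most 1. `S` does not reach the top coefficient, which gives `P` slope 1.
    have hid : P * Q = S + (X - C m) * Q.comp (X + C m) := by
      refine Polynomial.funext fun l => ?_
      have := h x l m
      simp only [hP, hS, hQ, eval_mul, eval_add, eval_sub, eval_X, eval_C, eval_comp,
        eval_map_evalRingHom_eq]
      change evalEval (l + x) m f * _ = _
      rw [add_comm l x]
      linear_combination this
    have hSd : S.natDegree ≤ f.natDegree :=
      (natDegree_C_mul_le _ _).trans (natDegree_map_le)
    have hcd : (Q.comp (X + C m)).natDegree = f.natDegree := by
      rw [natDegree_comp, natDegree_X_add_C, mul_one, hx]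
    have hcl : (Q.comp (X + C m)).coeff f.natDegree = Q.coeff f.natDegree := by
      have := leadingCoeff_comp (p := Q) (q := X + C m) (by simp)
      rw [leadingCoeff_X_add_C, one_pow, mul_one, leadingCoeff, leadingCoeff, hcd, hx] at this
      exact this
    have hQl : Q.coeff f.natDegree ≠ 0 := by
      rw [← hx]; exact leadingCoeff_ne_zero.2 hx0
    have hPd : P.natDegree ≤ 1 := by
      by_cases hP0 : P = 0
      · simp [hP0]
      have h1 : (P * Q).natDegree ≤ f.natDegree + 1 := by
        rw [hid]
        refine natDegree_add_le_of_degree_le (hSd.trans (Nat.le_succ _)) ?_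
        refine natDegree_mul_le.trans ?_
        rw [natDegree_X_sub_C, hcd, add_comm]
      rw [natDegree_mul hP0 hx0, hx] at h1
      omega
    have hP1 : P.coeff 1 = 1 := by
      have h1 := congrArg (fun q => q.coeff (1 + f.natDegree)) hid
      simp only [coeff_add] at h1
      rw [coeff_mul_add_eq_of_natDegree_le hPd hx.le,
        coeff_mul_add_eq_of_natDegree_le (natDegree_X_sub_C_le m) hcd.le,
        coeff_eq_zero_of_natDegree_lt (p := S) (by omega), hcl, zero_add] at h1
      rw [coeff_sub, coeff_X_one, coeff_C_succ, sub_zero, one_mul] at h1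
      exact mul_right_cancel₀ hQl (h1.trans (one_mul _).symm)
    obtain ⟨u, w, huw⟩ := exists_eq_X_add_C_of_natDegree_le_one hPd
    have hu : u = 1 := by rw [huw] at hP1; simpa using hP1
    have h1 := congrArg (eval (y - x)) huw
    have h2 := congrArg (eval 0) huw
    simp only [hP, eval_comp, eval_add, eval_X, eval_C, eval_mul, hu] at h1 h2
    rw [sub_add_cancel] at h1
    rw [zero_add] at h2
    change evalEval y m f = _ at h1
    change evalEval x m f = _ at h2
    rw [h1, h2]; ring
  obtain ⟨α, β, hαβ⟩ := linear_of_functional_eq Q (fun l m => by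
    have := h x l m
    rw [hlin (x + l) m, hlin (x + m) l] at this
    simp only [hQ, eval_map_evalRingHom_eq]
    linear_combination this)
  simp only [hQ, eval_map_evalRingHom_eq] at hαβ
  exact ⟨α, β - x, fun y l => by rw [hlin, hαβ]; ring⟩

/-- Commuting rank one actions do not depend on `∂`. -/
theorem eq_of_commuting {g : ℂ[X][X]}
    (h : ∀ x l m : ℂ, evalEval (x + l) m g * evalEval x l g =
      evalEval (x + m) l g * evalEval x m g) (x y m : ℂ) :
    evalEval x m g = evalEval y m g := by
  by_cases hg : g = 0
  · simp [hg]
  obtain ⟨z, hz, hz0⟩ := exists_natDegree_map_eq hg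
  set P := (g.eval (C m)).comp (X + C z) with hP
  -- Here no factor `l - m` appears, so the same degree comparison leaves `P` constant.
  have hid : P * g.map (evalRingHom z) =
      C (evalEval z m g) * g.map (evalRingHom (z + m)) := by
    refine Polynomial.funext fun l => ?_
    have := h z l m
    simp only [hP, eval_mul, eval_add, eval_X, eval_C, eval_comp, eval_map_evalRingHom_eq]
    change evalEval (l + z) m g * _ = _
    rw [add_comm l z]
    linear_combination this
  have hPd : P.natDegree = 0 := by
    by_cases hP0 : P = 0
    · simp [hP0]
    have h1 : (P * g.map (evalRingHom z)).natDegree ≤ g.natDegree := by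
      rw [hid]
      exact (natDegree_C_mul_le _ _).trans natDegree_map_le
    rw [natDegree_mul hP0 hz0, hz] at h1
    omega
  obtain ⟨u, hu⟩ := natDegree_eq_zero.1 hPd
  have h1 : ∀ y, evalEval y m g = u := fun y => by
    have := congrArg (eval (y - z)) hu
    simp only [hP, eval_comp, eval_add, eval_X, eval_C, sub_add_cancel] at this
    exact this.symm
  rw [h1, h1]

/-! ### Intertwiners between rank one Virasoro modules -/

/-- The Euler operator multiplies the coefficient of degree `n` by `n`, so only one degree can
survive. -/
theorem eq_C_mul_X_pow_of_euler {c : ℂ[X]} {κ : ℂ} (hc : c ≠ 0)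
    (h : X * derivative c = C κ * c) : ∃ (k : ℕ) (u : ℂ), κ = k ∧ u ≠ 0 ∧ c = C u * X ^ k := by
  have hco : ∀ n : ℕ, c.coeff n ≠ 0 → κ = n := by
    intro n hn
    have h1 := congrArg (fun q => q.coeff n) h
    have h2 : (X * derivative c).coeff n = n * c.coeff n := by
      cases n with
      | zero => simp
      | succ n => rw [coeff_X_mul, coeff_derivative]; push_cast; ring
    simp only [h2, coeff_C_mul] at h1
    exact (mul_right_cancel₀ hn h1).symm
  refine ⟨c.natDegree, c.leadingCoeff, hco _ (leadingCoeff_ne_zero.2 hc),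
    leadingCoeff_ne_zero.2 hc, ?_⟩
  ext n
  rw [coeff_C_mul_X_pow]
  split_ifs with hn
  · rw [hn, leadingCoeff]
  · by_contra h1
    have h2 := hco n h1
    rw [hco _ (leadingCoeff_ne_zero.2 hc)] at h2
    exact hn (by exact_mod_cast h2.symm)

/-- The intertwining equation for the densities of weights `α`, `α'` at the point `(1, 1)`. -/
theorem intertwiner_exponent {α α' : ℂ} {k : ℕ} (hk : 1 + α - α' = k)
    (h : ∀ x : ℂ, (x + 1 + α) * ((x + α') * (x + 1) ^ k - (x + α) * x ^ k) =
      (x + α') * ((x + 1 + α') * (x + 2) ^ k - (x + 1 + α) * (x + 1) ^ k)) :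
    k = 0 ∨ k = 1 ∨ (k = 2 ∧ α = 1 ∧ α' = 0) := by
  rcases Nat.eq_zero_or_pos k with h0 | h0
  · exact Or.inl h0
  have hk0 : (k : ℂ) ≠ 0 := by exact_mod_cast h0.ne'
  by_cases h1 : k = 1
  · exact Or.inr (Or.inl h1)
  -- The factor `x + α'` kills the right side.
  have h2 := h (-α')
  have h3 : (k : ℂ) * ((k - 1) * (-α') ^ k) = 0 := by
    rw [← hk]
    linear_combination -h2
  have hk1 : (k : ℂ) - 1 ≠ 0 := sub_ne_zero.2 (by exact_mod_cast h1)
  have hα' : α' = 0 := by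
    have := (mul_eq_zero.1 ((mul_eq_zero.1 h3).resolve_left hk0)).resolve_left hk1
    simpa using (pow_eq_zero_iff h0.ne').1 this
  subst hα'
  -- Now `α' = 0`, and every power of `x + 1` vanishes at `-1` because `k > 0`.
  have h4 := h (-1)
  have hα : α = k - 1 := by linear_combination hk
  have h5 : α * ((1 - α) * (-1) ^ k) = 0 := by
    simp only [neg_add_cancel, zero_pow h0.ne'] at h4
    linear_combination h4
  have h6 : (1 - α) = 0 := by
    rw [hα] at h5 ⊢
    have := (mul_eq_zero.1 h5).resolve_left hk1
    exact (mul_eq_zero.1 this).resolve_right (pow_ne_zero _ (by norm_num))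
  have hα1 : α = 1 := by linear_combination -h6
  refine Or.inr (Or.inr ⟨?_, hα1, rfl⟩)
  have : (k : ℂ) = 2 := by rw [← hk, hα1]; norm_num
  exact_mod_cast this

/-- The equation at `l = 0` recovers `h` from its restriction `c` to `λ = 0`. Its first order part
in `m` is the Euler equation `x c' = (1 + α - α') c`, so `c = u x^k` with `k = 1 + α - α'`. The
values `k = 0, 1, 2` that remain are the three cases. -/
theorem intertwiner_centered {h : ℂ[X][X]} (h0 : h ≠ 0) {α α' : ℂ}
    (hint : ∀ x l m : ℂ, (x + l + α * m) * evalEval x l h -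
      (x + α' * m) * evalEval (x + m) l h = (l - m) * evalEval x (l + m) h) :
    ∃ u : ℂ, u ≠ 0 ∧
      ((α' = α + 1 ∧ ∀ x l, evalEval x l h = u) ∨
       (α' = α ∧ ∀ x l, evalEval x l h = u * (x + α * l)) ∨
       (α = 1 ∧ α' = 0 ∧ ∀ x l, evalEval x l h = u * (x * (x + l)))) := by
  set c := h.eval (C 0) with hcdef
  have hc : ∀ x, evalEval x 0 h = c.eval x := fun x => rfl
  have hform : ∀ x m, m * evalEval x m h = (x + α' * m) * c.eval (x + m) - (x + α * m) * c.eval x := by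
    intro x m
    have := hint x 0 m
    rw [hc, hc, zero_add] at this
    linear_combination this
  have heuler : X * derivative c = C (1 + α - α') * c := by
    refine Polynomial.funext fun x => ?_
    -- Differentiation of this identity in `m` at `0` yields the Euler equation.
    have h1 : X * h.map (evalRingHom x) =
        (C x + C α' * X) * c.comp (X + C x) - (C x + C α * X) * C (c.eval x) := by
      refine Polynomial.funext fun m => ?_
      simp only [eval_mul, eval_sub, eval_add, eval_X, eval_C, eval_comp, eval_map_evalRingHom_eq]
      rw [hform, add_comm m x]
    have h2 := congrArg (fun q => (derivative q).eval 0) h1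
    simp [derivative_comp] at h2
    rw [show eval x (eval 0 h) = eval x c by rw [hcdef, C_0]] at h2
    simp only [eval_mul, eval_X, eval_C]
    linear_combination -h2
  have hc0 : c ≠ 0 := by
    intro hc0
    refine h0 (evalEval_ext fun x m => ?_)
    by_cases hm : m = 0
    · rw [hm, hc, hc0]; simp
    · have := hform x m
      simp only [hc0, eval_zero, mul_zero, sub_zero] at this
      simpa using (mul_eq_zero.1 this).resolve_left hm
  obtain ⟨k, u, hκ, hu, hck⟩ := eq_C_mul_X_pow_of_euler hc0 heuler
  have hcx : ∀ x, c.eval x = u * x ^ k := fun x => by rw [hck]; simp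
  simp only [hcx] at hform
  have hval : ∀ (w x m : ℂ), (m ≠ 0 → m * w = (x + α' * m) * (u * (x + m) ^ k) -
      (x + α * m) * (u * x ^ k)) → (m = 0 → w = u * x ^ k) → evalEval x m h = w := by
    intro w x m h1 h2
    by_cases hm : m = 0
    · rw [h2 hm, hm, hc, hcx]
    · exact mul_left_cancel₀ hm ((hform x m).trans (h1 hm).symm)
  refine ⟨u, hu, ?_⟩
  -- At `l = m = 1` the right side of the intertwining equation vanishes, leaving a condition on
  -- `k`, `α`, `α'` alone.
  have hexp := intertwiner_exponent hκ (fun x => by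
    have h1 := hint x 1 1
    have h2 := hform x 1
    have h3 := hform (x + 1) 1
    rw [show x + 1 + 1 = x + 2 by ring] at h3
    refine mul_left_cancel₀ hu ?_
    linear_combination h1 - (x + 1 + α) * h2 + (x + α') * h3)
  rcases hexp with rfl | rfl | ⟨rfl, rfl, rfl⟩
  · have hα : α' = α + 1 := by push_cast at hκ; linear_combination -hκ
    exact Or.inl ⟨hα, fun x m => hval _ _ _ (fun _ => by rw [hα]; ring) fun _ => by simp⟩
  · have hα : α' = α := by push_cast at hκ; linear_combination -hκ
    refine Or.inr (Or.inl ⟨hα, fun x m => hval _ _ _ (fun _ => by rw [hα]; ring) ?_⟩)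
    rintro rfl; simp
  · refine Or.inr (Or.inr ⟨rfl, rfl, fun x m => hval _ _ _ (fun _ => by ring) ?_⟩)
    rintro rfl; ring

/-- Nonzero maps `f` with `[L_0, L_i] = L_i` between rank one modules over the Virasoro conformal
algebra. -/
theorem intertwiner {f : ℂ[X][X]} (hf : f ≠ 0) {α β α' β' : ℂ}
    (hint : ∀ x l m : ℂ, (x + l + α * m + β) * evalEval x l f -
      (x + α' * m + β') * evalEval (x + m) l f = (l - m) * evalEval x (l + m) f) :
    β' = β ∧ ∃ u : ℂ, u ≠ 0 ∧
      ((α' = α + 1 ∧ ∀ x l, evalEval x l f = u) ∨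
       (α' = α ∧ ∀ x l, evalEval x l f = u * (x + α * l + β)) ∨
       (α = 1 ∧ α' = 0 ∧ ∀ x l, evalEval x l f = u * ((x + β) * (x + β + l)))) := by
  have hβ : β' = β := by
    obtain ⟨x, l, hx⟩ := exists_evalEval_ne_zero hf
    -- At `m = 0` the equation reduces to `(β - β') f(x, l) = 0`.
    have := hint x l 0
    rw [add_zero, add_zero] at this
    refine mul_right_cancel₀ hx ?_
    linear_combination -this
  subst hβ
  -- The shift `∂ ↦ ∂ - β` reduces to the case `β = 0`.
  set h : ℂ[X][X] := f.map (compRingHom (X - C β')) with hh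
  have hev : ∀ x l, evalEval x l h = evalEval (x - β') l f := by
    intro x l
    rw [← eval_map_evalRingHom_eq, ← eval_map_evalRingHom_eq, hh, map_map]
    congr 2
    ext <;> simp
  have hev' : ∀ x l, evalEval x l f = evalEval (x + β') l h := by
    intro x l; rw [hev, add_sub_cancel_right]
  have h0 : h ≠ 0 := by
    intro h0
    refine hf (evalEval_ext fun x l => ?_)
    rw [hev', h0]; simp
  obtain ⟨u, hu, H⟩ := intertwiner_centered (h := h) h0 (α := α) (α' := α') (fun x l m => by
    have := hint (x - β') l m
    rw [hev, hev, hev, show x + m - β' = x - β' + m by ring]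
    linear_combination this)
  refine ⟨rfl, u, hu, ?_⟩
  rcases H with ⟨h1, h2⟩ | ⟨h1, h2⟩ | ⟨h1, h3, h2⟩
  · exact Or.inl ⟨h1, fun x l => by rw [hev', h2]⟩
  · exact Or.inr (Or.inl ⟨h1, fun x l => by rw [hev', h2]; ring⟩)
  · exact Or.inr (Or.inr ⟨h1, h3, fun x l => by rw [hev', h2]⟩)

/-! ### The coefficients of the `L_i` -/

/-- The equations for coefficients `L_i _λ v_m = f i m (∂, λ) v_{i+m}` of a module over the loop
Virasoro Lie conformal algebra. -/
def IsLoopVirasoro (f : ℤ → ℤ → ℂ[X][X]) : Prop :=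
  ∀ (i j m : ℤ) (x s t : ℂ),
    evalEval (x + s) t (f j m) * evalEval x s (f i (j + m)) -
      evalEval (x + t) s (f i m) * evalEval x t (f j (i + m)) =
    (s - t) * evalEval x (s + t) (f (i + j) m)

namespace IsLoopVirasoro

variable {f : ℤ → ℤ → ℂ[X][X]}

theorem eq_zero_of_forall_mul {p : ℂ[X][X]}
    (h : ∀ x s t : ℂ, (s - t) * evalEval x (s + t) p = 0) : p = 0 := by
  refine evalEval_ext fun x y => ?_
  have := h x (y / 2 + 1) (y / 2 - 1)
  rw [show y / 2 + 1 + (y / 2 - 1) = y by ring] at this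
  simpa using (mul_eq_zero.1 this).resolve_left (by ring_nf; norm_num)

/-- One of the two products on the left of the relation disappears. The right side vanishes for `s =
t`, so by `eq_zero_or_of_diag` a factor of the other product is zero; the left side is then
identically zero. The next three lemmas use the same device. -/
theorem eq_zero_of_source (hf : IsLoopVirasoro f) {m : ℤ} (h : f 0 m = 0) (i : ℤ) :
    f i m = 0 := by
  have h1 := hf 0 i m
  simp only [h, zero_add, evalEval_zero, zero_mul, sub_zero] at h1
  rcases eq_zero_or_of_diag (f := f i m) (g := f 0 (i + m)) (fun x l => by rw [h1]; simp)
    with h2 | h2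
  · exact h2
  · exact eq_zero_of_forall_mul fun x s t => by rw [← h1, h2]; simp

theorem eq_zero_of_target (hf : IsLoopVirasoro f) {i m : ℤ} (h : f 0 (i + m) = 0) :
    f i m = 0 := by
  have h1 := hf 0 i m
  simp only [h, zero_add, evalEval_zero, mul_zero, zero_sub] at h1
  rcases eq_zero_or_of_diag (f := f 0 m) (g := f i m)
    (fun x l => neg_eq_zero.1 (by rw [h1]; simp)) with h2 | h2
  · exact eq_zero_of_source hf h2 i
  · exact h2

theorem zero_ne_zero (hf : IsLoopVirasoro f) (hne : ∃ i m, f i m ≠ 0) (m : ℤ) : f 0 m ≠ 0 := by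
  intro h
  obtain ⟨i, n, hn⟩ := hne
  refine hn (hf.eq_zero_of_source ?_ i)
  -- On `V_n`, `[L_{n-m}, L_{m-n}]` is a multiple of `L_0`, and the path through `V_m` contributes
  -- nothing.
  have h1 := hf (n - m) (m - n) n
  have h2 : f (m - n) n = 0 := hf.eq_zero_of_target (by rwa [sub_add_cancel])
  simp only [h2, evalEval_zero, zero_mul, zero_sub, sub_add_sub_cancel, sub_self] at h1
  refine eq_zero_of_forall_mul fun x s t => ?_
  rw [← h1]
  rcases eq_zero_or_of_diag (f := f (n - m) n) (g := f (m - n) (n - m + n))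
    (fun x l => neg_eq_zero.1 (by rw [h1]; simp)) with h3 | h3 <;> simp [h3]

theorem ne_zero (hf : IsLoopVirasoro f) (hne : ∃ i m, f i m ≠ 0) (i m : ℤ) : f i m ≠ 0 := by
  intro h
  refine hf.zero_ne_zero hne m ?_
  have h1 := hf i (-i) m
  simp only [h, evalEval_zero, zero_mul, sub_zero, add_neg_cancel] at h1
  refine eq_zero_of_forall_mul fun x s t => ?_
  rw [← h1]
  rcases eq_zero_or_of_diag (f := f (-i) m) (g := f i (-i + m))
    (fun x l => by rw [h1]; simp) with h3 | h3 <;> simp [h3]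

/-- Two solutions that are proportional differ by a change of generators. -/
theorem exists_rescaling {F : ℤ → ℤ → ℂ[X][X]} (hf : IsLoopVirasoro f) (hF : IsLoopVirasoro F)
    (hF0 : ∀ i m, F i m ≠ 0)
    (h : ∀ i m, ∃ u : ℂ, u ≠ 0 ∧ ∀ x l, evalEval x l (f i m) = u * evalEval x l (F i m)) :
    ∃ c : ℤ → ℂ, (∀ m, c m ≠ 0) ∧
      ∀ i m, C (C (c m)) * f i m = C (C (c (i + m))) * F i m := by
  choose u hu hfu using h
  -- This cocycle identity makes `c m = u m 0` the rescaling factor. The relations for `f` and `F`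
  -- at `s = t` show that both products carry the same scalar; off the diagonal this scalar must
  -- equal that of `f (i + m) 0`.
  have hcoc : ∀ i m, u i m * u m 0 = u (i + m) 0 := by
    intro i m
    have hcomm : u m 0 * u i (m + 0) = u i 0 * u m (i + 0) := by
      by_contra hne
      have hz : ∀ x l, evalEval (x + l) l (F m 0) * evalEval x l (F i (m + 0)) = 0 := by
        intro x l
        have h1 := hf i m 0 x l l
        have h2 := hF i m 0 x l l
        simp only [hfu] at h1
        refine (mul_eq_zero.1 ?_).resolve_left (sub_ne_zero.2 hne)
        linear_combination h1 - u i 0 * u m (i + 0) * h2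
      rcases eq_zero_or_of_diag hz with h3 | h3 <;> exact hF0 _ _ h3
    have h3 : u m 0 * u i (m + 0) = u (i + m) 0 := by
      by_contra hne
      refine hF0 (i + m) 0 (eq_zero_of_forall_mul fun x s t => ?_)
      have h1 := hf i m 0 x s t
      have h2 := hF i m 0 x s t
      simp only [hfu] at h1
      refine (mul_eq_zero.1 ?_).resolve_left (sub_ne_zero.2 hne)
      linear_combination h1 - u m 0 * u i (m + 0) * h2 - hcomm * evalEval (x + t) s (F i 0) *
        evalEval x t (F m (i + 0))
    rw [add_zero] at h3
    rw [← h3, mul_comm]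
  refine ⟨fun m => u m 0, fun m => hu m 0, fun i m => evalEval_ext fun x l => ?_⟩
  simp only [evalEval_mul, evalEval_C, eval_C, hfu, ← hcoc]
  ring

end IsLoopVirasoro

/-! ### Model solutions and classification of the `L_i`-action -/

theorem isLoopVirasoro_first (α β : ℂ) :
    IsLoopVirasoro fun _ _ => C X + C (C α) * X + C (C β) := by
  intro i j m x s t
  simp only [evalEval_add, evalEval_mul, evalEval_C, eval_C, eval_X, evalEval_X]
  ring

theorem evalEval_secondCoeff (A : ℤ → Fin 2) (β : ℂ) (i m : ℤ) (x l : ℂ) :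
    evalEval x l (secondCoeff A β i m) =
      match A m, A (i + m) with
      | 0, 0 => x + β
      | 1, 1 => x + β + l
      | 0, 1 => 1
      | 1, 0 => (x + β) * (x + β + l) := by
  unfold secondCoeff
  generalize A m = p
  generalize A (i + m) = q
  fin_cases p <;> fin_cases q <;> simp [evalEval_add, evalEval_mul, evalEval_C]

theorem fin_two_cases (p : Fin 2) : p = 0 ∨ p = 1 := by omega

theorem isLoopVirasoro_second (A : ℤ → Fin 2) (β : ℂ) : IsLoopVirasoro (secondCoeff A β) := by
  intro i j m x s t
  simp only [evalEval_secondCoeff, ← add_assoc]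
  rw [add_comm j i]
  rcases fin_two_cases (A m) with h1 | h1 <;> rcases fin_two_cases (A (i + m)) with h2 | h2 <;>
  rcases fin_two_cases (A (j + m)) with h3 | h3 <;>
  rcases fin_two_cases (A (i + j + m)) with h4 | h4 <;>
  simp only [h1, h2, h3, h4] <;> ring

theorem first_ne_zero (α β : ℂ) : (C X + C (C α) * X + C (C β) : ℂ[X][X]) ≠ 0 := by
  intro h
  have := congrArg (evalEval (1 - β) 0) h
  simp [evalEval_add, evalEval_mul, evalEval_C] at this

theorem secondCoeff_ne_zero (A : ℤ → Fin 2) (β : ℂ) (i m : ℤ) : secondCoeff A β i m ≠ 0 := by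
  intro h
  have := congrArg (evalEval (1 - β) 0) h
  rw [evalEval_secondCoeff] at this
  rcases fin_two_cases (A m) with h1 | h1 <;> rcases fin_two_cases (A (i + m)) with h2 | h2 <;>
    simp [h1, h2] at this

/-- The second alternative records that `A` is not constant, which is what later forces the `M_i` to
act by zero. -/
theorem IsLoopVirasoro.classification {f : ℤ → ℤ → ℂ[X][X]} (hf : IsLoopVirasoro f)
    (hne : ∃ i m, f i m ≠ 0) :
    ∃ c : ℤ → ℂ, (∀ m, c m ≠ 0) ∧
      ((∃ α β : ℂ, ∀ i m, C (C (c m)) * f i m =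
          C (C (c (i + m))) * (C X + C (C α) * X + C (C β))) ∨
       ∃ (A : ℤ → Fin 2) (β : ℂ), (∃ m n, A m = 0 ∧ A n = 1) ∧
        ∀ i m, C (C (c m)) * f i m = C (C (c (i + m))) * secondCoeff A β i m) := by
  have hvir : ∀ m, ∃ α β : ℂ, ∀ x l, evalEval x l (f 0 m) = x + α * l + β := fun m =>
    virasoro_rank_one (hf.zero_ne_zero hne m) fun x s t => by simpa using hf 0 0 m x s t
  choose α β' hαβ using hvir
  have hint := fun i m => intertwiner (hf.ne_zero hne i m) (α := α m) (β := β' m)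
    (α' := α (i + m)) (β' := β' (i + m)) (fun x s t => by
      have h1 := hf i 0 m x s t
      simp only [hαβ, zero_add, add_zero] at h1
      linear_combination h1)
  have hβ : ∀ m, β' m = β' 0 := fun m => by simpa using (hint m 0).1
  obtain ⟨β, hβ⟩ : ∃ β, ∀ m, β' m = β := ⟨_, hβ⟩
  simp only [hβ] at hint hαβ
  have htri : ∀ m n, α n = α m + 1 ∨ α n = α m ∨ (α m = 1 ∧ α n = 0) := by
    intro m n
    obtain ⟨-, u, -, h⟩ := hint (n - m) m
    rw [sub_add_cancel] at h
    tauto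
  by_cases hconst : ∀ m, α m = α 0
  · obtain ⟨c, hc, h⟩ := hf.exists_rescaling (isLoopVirasoro_first (α 0) β)
      (fun _ _ => first_ne_zero _ _) (fun i m => by
        obtain ⟨-, u, hu, h⟩ := hint i m
        rw [hconst, hconst m] at h
        refine ⟨u, hu, fun x l => ?_⟩
        rcases h with ⟨h, -⟩ | ⟨-, h⟩ | ⟨h, h', -⟩
        · simp at h
        · rw [h]; simp [evalEval_add, evalEval_mul, evalEval_C]
        · rw [h] at h'; simp at h')
    exact ⟨c, hc, Or.inl ⟨α 0, β, h⟩⟩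
  · obtain ⟨p, q, hp, hq⟩ : ∃ p q, α p = 0 ∧ α q = 1 := by
      push Not at hconst
      obtain ⟨n, hn⟩ := hconst
      -- The weight cannot rise by one both from `n` to `0` and back. As the two weights differ, one
      -- direction is the exceptional passage from 1 to 0.
      rcases htri n 0 with h1 | h1 | h1 <;> rcases htri 0 n with h2 | h2 | h2
      · exfalso
        have : (2 : ℂ) = 0 := by linear_combination -h1 - h2
        norm_num at this
      · exact absurd h2 hn
      · exact ⟨n, 0, h2.2, h2.1⟩
      · exact absurd h1.symm hn
      · exact absurd h1.symm hn
      · exact absurd h1.symm hn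
      · exact ⟨0, n, h1.2, h1.1⟩
      · exact absurd h2 hn
      · exact absurd (h1.1.symm.trans h2.2) one_ne_zero
    have h01 : ∀ m, α m = 0 ∨ α m = 1 := by
      intro m
      rcases htri p m with h1 | h1 | h1
      · right; rw [h1, hp, zero_add]
      · left; rw [h1, hp]
      · exact Or.inl h1.2
    classical
    set A : ℤ → Fin 2 := fun m => if α m = 0 then 0 else 1 with hA
    have hA0 : ∀ {m}, α m = 0 → A m = 0 := fun h => by simp [hA, h]
    have hA1 : ∀ {m}, α m = 1 → A m = 1 := fun h => by simp [hA, h]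
    obtain ⟨c, hc, h⟩ := hf.exists_rescaling (isLoopVirasoro_second A β)
      (fun _ _ => secondCoeff_ne_zero _ _ _ _) (fun i m => by
        obtain ⟨-, u, hu, h⟩ := hint i m
        refine ⟨u, hu, fun x l => ?_⟩
        rw [evalEval_secondCoeff]
        rcases h01 m with h1 | h1 <;> rcases h01 (i + m) with h2 | h2 <;> rw [h1, h2] at h
        · simp only [hA0 h1, hA0 h2]
          simp at h
          rw [h]
        · simp only [hA0 h1, hA1 h2]
          simp at h
          rw [h, mul_one]
        · simp only [hA1 h1, hA0 h2]
          rcases h with h | h | h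
          · exfalso; have := h.1; norm_num at this
          · exfalso; have := h.1; norm_num at this
          · exact h.2.2 x l
        · simp only [hA1 h1, hA1 h2]
          simp at h
          rw [h]; ring)
    exact ⟨c, hc, Or.inr ⟨A, β, ⟨p, q, hA0 hp, hA1 hq⟩, h⟩⟩

/-! ### The coefficients of the `M_i` -/

/-- The equations expressing `[L_i _λ M_j] = (∂ + a λ + b) M_{i+j}` and `[M_i _λ M_j] = 0` for
coefficients `L_i _λ v_m = f i m (∂, λ) v_{i+m}` and `M_i _λ v_m = g i m (∂, λ) v_{i+m}`. -/
structure IsLoopExtension (a b : ℂ) (f g : ℤ → ℤ → ℂ[X][X]) : Prop where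
  lm : ∀ (i j m : ℤ) (x s t : ℂ),
    evalEval (x + s) t (g j m) * evalEval x s (f i (j + m)) -
      evalEval (x + t) s (f i m) * evalEval x t (g j (i + m)) =
    ((a - 1) * s - t + b) * evalEval x (s + t) (g (i + j) m)
  mm : ∀ (i j m : ℤ) (x s t : ℂ),
    evalEval (x + s) t (g j m) * evalEval x s (g i (j + m)) =
      evalEval (x + t) s (g i m) * evalEval x t (g j (i + m))

theorem eq_zero_of_forall_sub_mul {b : ℂ} {p : ℂ[X][X]}
    (h : ∀ x t : ℂ, (b - t) * evalEval x t p = 0) : p = 0 := by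
  have h1 : (C (C b) - X) * p = 0 := evalEval_ext fun x t => by
    simp only [evalEval_mul, evalEval_sub, evalEval_C, eval_C, evalEval_X, evalEval_zero]
    exact h x t
  refine (mul_eq_zero.1 h1).resolve_left fun h2 => ?_
  have := congrArg (evalEval 0 (b + 1)) h2
  simp [evalEval_sub, evalEval_C] at this

namespace IsLoopExtension

variable {a b : ℂ} {f g : ℤ → ℤ → ℂ[X][X]}

theorem zero_apply (h : IsLoopExtension a b f g) {m : ℤ} {α β : ℂ}
    (hf : ∀ x l, evalEval x l (f 0 m) = x + α * l + β) :
    ∃ d : ℂ, (∀ x l, evalEval x l (g 0 m) = d) ∧ (a ≠ 1 ∨ b ≠ 0 → d = 0) := by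
  set p := (g 0 m).map (evalRingHom 0) with hp
  have hgp : ∀ x l, evalEval x l (g 0 m) = p.eval l := fun x l => by
    rw [hp, eval_map_evalRingHom_eq]
    exact eq_of_commuting (fun x s t => by simpa using h.mm 0 0 m x s t) _ _ _
  -- The relation of `L_0` with `M_0`; the weights `α`, `β` cancel. Setting `s = -t`, `s = 0` or `t
  -- = 0` settles the three cases for `a`, `b`.
  have key : ∀ s t, -t * p.eval t = ((a - 1) * s - t + b) * p.eval (s + t) := fun s t => by
    have h1 := h.lm 0 0 m 0 s t
    simp only [add_zero, zero_add, hgp, hf] at h1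
    rw [← h1]
    ring
  have hconst : a = 1 → b = 0 → ∀ t, p.eval t = p.eval 0 := by
    rintro rfl rfl t
    by_cases ht : t = 0
    · rw [ht]
    refine mul_left_cancel₀ (neg_ne_zero.2 ht) ?_
    rw [key (-t) t, neg_add_cancel]
    ring
  have hb : b ≠ 0 → p = 0 := fun hb => Polynomial.funext fun t => by
    have h1 := key 0 t
    rw [zero_add] at h1
    have : b * p.eval t = 0 := by linear_combination -h1
    simpa using (mul_eq_zero.1 this).resolve_left hb
  have ha : a ≠ 1 → b = 0 → p = 0 := by
    rintro ha rfl
    have h1 : C (a - 1) * X * p = 0 := Polynomial.funext fun s => by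
      have h1 := key s 0
      simp only [add_zero] at h1
      simp only [eval_mul, eval_C, eval_X, eval_zero]
      linear_combination -h1
    refine (mul_eq_zero.1 h1).resolve_left (mul_ne_zero ?_ X_ne_zero)
    exact C_ne_zero.2 (sub_ne_zero.2 ha)
  by_cases hab : a = 1 ∧ b = 0
  · exact ⟨p.eval 0, fun x l => by rw [hgp, hconst hab.1 hab.2], fun h => by tauto⟩
  · have hp0 : p = 0 := by
      by_cases hb0 : b = 0
      · exact ha (fun h => hab ⟨h, hb0⟩) hb0
      · exact hb hb0
    exact ⟨0, fun x l => by rw [hgp, hp0, eval_zero], fun _ => rfl⟩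

/-- All `M_i` are determined by the constants by which `M_0` acts. -/
theorem exists_const (h : IsLoopExtension a b f g) (hf : ∀ i m, f i m ≠ 0)
    (hf0 : ∀ m, ∃ α β : ℂ, ∀ x l, evalEval x l (f 0 m) = x + α * l + β) :
    ∃ d : ℂ, (∀ m x l, evalEval x l (g 0 m) = d) ∧ (a ≠ 1 ∨ b ≠ 0 → d = 0) ∧
      (d = 0 → ∀ i m, g i m = 0) ∧
      ∀ i m x t, t * evalEval x t (g i m) =
        d * (evalEval (x + t) 0 (f i m) - evalEval x 0 (f i m)) := by
  choose α β hαβ using hf0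
  choose d hd hd0 using fun m => h.zero_apply (hαβ m)
  have key : ∀ i m x s t, d m * evalEval x s (f i m) - evalEval (x + t) s (f i m) * d (i + m) =
      ((a - 1) * s - t + b) * evalEval x (s + t) (g i m) := by
    intro i m x s t
    simpa [hd] using h.lm i 0 m x s t
  have hzero : (∀ m, d m = 0) → ∀ i m, g i m = 0 := by
    intro hd0 i m
    refine eq_zero_of_forall_sub_mul (b := b) fun x t => ?_
    have := key i m x 0 t
    simp only [hd0, zero_add] at this
    linear_combination -this
  by_cases hab : a = 1 ∧ b = 0
  · obtain ⟨rfl, rfl⟩ := hab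
    have hdc : ∀ m, d m = d 0 := by
      intro m
      obtain ⟨x, l, hx⟩ := exists_evalEval_ne_zero (hf m 0)
      -- At `t = 0` the factor on the right is zero, so the nonzero `f m 0` forces equal constants
      -- in degrees `0` and `m`.
      have h1 := key m 0 x l 0
      rw [add_zero, add_zero, add_zero] at h1
      refine mul_right_cancel₀ hx ?_
      linear_combination -h1
    refine ⟨d 0, fun m x l => by rw [hd, hdc], fun h => by tauto,
      fun h => hzero fun m => by rw [hdc, h], fun i m x t => ?_⟩
    have h1 := key i m x 0 t
    rw [hdc m, hdc (i + m), zero_add] at h1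
    linear_combination h1
  · have hab' : a ≠ 1 ∨ b ≠ 0 := by tauto
    have hd0' : ∀ m, d m = 0 := fun m => hd0 m hab'
    refine ⟨0, fun m x l => by rw [hd, hd0'], fun _ => rfl, fun _ => hzero hd0',
      fun i m x t => ?_⟩
    rw [hzero hd0']
    simp

theorem first {α β : ℂ} (h : IsLoopExtension a b (fun _ _ => C X + C (C α) * X + C (C β)) g) :
    ∃ d : ℂ, (∀ i m, g i m = C (C d)) ∧ (a ≠ 1 ∨ b ≠ 0 → d = 0) := by
  obtain ⟨d, -, hd0, -, hd⟩ := h.exists_const (fun _ _ => first_ne_zero _ _) fun _ =>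
    ⟨α, β, fun x l => by simp [evalEval_add, evalEval_mul, evalEval_C]⟩
  refine ⟨d, fun i m => mul_left_cancel₀ (X_ne_zero (R := ℂ[X])) (evalEval_ext fun x t => ?_), hd0⟩
  have := hd i m x t
  simp only [evalEval_add, evalEval_mul, evalEval_C, evalEval_X, eval_C, eval_X] at this ⊢
  linear_combination this

theorem second {A : ℤ → Fin 2} {β : ℂ} (h : IsLoopExtension a b (secondCoeff A β) g)
    (hA : ∃ p q, A p = 0 ∧ A q = 1) (i m : ℤ) : g i m = 0 := by
  obtain ⟨d, hg0, hd0, hz, hd⟩ := h.exists_const (secondCoeff_ne_zero A β) fun m => by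
    rcases fin_two_cases (A m) with h1 | h1
    · exact ⟨0, β, fun x l => by simp only [evalEval_secondCoeff, zero_add, h1]; ring⟩
    · exact ⟨1, β, fun x l => by simp only [evalEval_secondCoeff, zero_add, h1]; ring⟩
  refine hz ?_ i m
  by_cases hab : a ≠ 1 ∨ b ≠ 0
  · exact hd0 hab
  obtain ⟨rfl, rfl⟩ : a = 1 ∧ b = 0 := by tauto
  obtain ⟨p, q, hp, hq⟩ := hA
  -- Evaluate at `∂ + β = 1`, `s = 0`, `t = 1`. There `M_{p-q}` acts on `v_q` by `(2² - 1²)d = 3d`,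
  -- and on `v_p` by `d` or `0` according as `A (p - q + p)` is 0 or 1. The bracket with value `M_0`
  -- then reads `d - 3d = -d` or `-3d = -d`.
  have h1 := h.lm (q - p) (p - q) p (1 - β) 0 1
  have h2 := hd (p - q) q (1 - β) 1
  have h3 := hd (p - q) p (1 - β) 1
  rw [show q - p + (p - q) = 0 by ring, hg0] at h1
  simp only [evalEval_secondCoeff, sub_add_cancel, hp, hq] at h1 h2 h3
  rcases fin_two_cases (A (p - q + p)) with h4 | h4 <;>
    simp only [h4, show q - p + (p - q + p) = p by ring, hp, add_zero] at h1 h3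
  · linear_combination -h1 + h3 - h2
  · linear_combination (-1 / 2) * (h1 + h2 - h3)

end IsLoopExtension

/-! ### Free generators of the graded components -/

section Generators

variable {V : Type*} [AddCommGroup V] [Module ℂ[X] V]

theorem exists_eq_smul_single {w : V} (P : LamPoly V)
    (h : ∀ n, P.coeff n ∈ Submodule.span ℂ[X] {w}) :
    ∃ F : ℂ[X][X], P = F • PolynomialModule.single ℂ[X] 0 w := by
  choose p hp using fun n => Submodule.mem_span_singleton.1 (h n)
  refine ⟨∑ n ∈ P.coeff.support, monomial n (p n), ?_⟩
  ext n
  rw [PolynomialModule.smul_single_apply]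
  simp only [zero_le, if_true, tsub_zero, finsetSum_coeff, coeff_monomial, Finset.sum_ite_eq']
  split_ifs with hn
  · exact (hp n).symm
  · rw [zero_smul]; simpa using hn

theorem atLam_smul_single (l : ℂ) (F : ℂ[X][X]) (w : V) :
    atLam l (F • PolynomialModule.single ℂ[X] 0 w) = F.eval (C l) • w := by
  rw [atLam, PolynomialModule.eval_smul, PolynomialModule.eval_single, pow_zero, one_smul]

theorem smul_single_injective {w : V} (hw : ∀ p : ℂ[X], p • w = 0 → p = 0) {F G : ℂ[X][X]}
    (h : F • PolynomialModule.single ℂ[X] 0 w = G • PolynomialModule.single ℂ[X] 0 w) : F = G := by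
  ext1 n
  have h1 := congrArg (fun P : LamPoly V => P.coeff n) h
  simp only [PolynomialModule.smul_single_apply, zero_le, if_true, tsub_zero] at h1
  exact sub_eq_zero.1 (hw _ (by rw [sub_smul, h1, sub_self]))

theorem map_lamPoly_smul {W : Type*} [AddCommGroup W] [Module ℂ[X] W] (φ : V →ₗ[ℂ[X]] W) (F : ℂ[X][X]) (P : LamPoly V) :
    PolynomialModule.map ℂ[X] φ (F • P) =
      F • PolynomialModule.map ℂ[X] φ P := by
  rw [PolynomialModule.map_smul, Algebra.algebraMap_self, Polynomial.map_id]

/-- The components `gr m` are freely generated by the elements `v m`. -/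
def IsGenerating (gr : ℤ → Submodule ℂ[X] V) (v : ℤ → V) : Prop :=
  ∀ m, gr m = Submodule.span ℂ[X] {v m} ∧ ∀ p : ℂ[X], p • v m = 0 → p = 0

theorem IsGenerating.rescale {gr : ℤ → Submodule ℂ[X] V} {v : ℤ → V} (hv : IsGenerating gr v)
    {c : ℤ → ℂ} (hc : ∀ m, c m ≠ 0) : IsGenerating gr fun m => (C (c m) : ℂ[X]) • v m := by
  intro m
  refine ⟨?_, fun p hp => ?_⟩
  · rw [(hv m).1, Submodule.span_singleton_smul_eq]
    exact isUnit_C.2 (isUnit_iff_ne_zero.2 (hc m))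
  · rw [smul_smul] at hp
    exact (mul_eq_zero.1 ((hv m).2 _ hp)).resolve_right (C_ne_zero.2 (hc m))

theorem IsGenerating.exists_basis {gr : ℤ → Submodule ℂ[X] V} {v : ℤ → V}
    (hv : IsGenerating gr v) (hgr : DirectSum.IsInternal gr) :
    ∃ B : Module.Basis ℤ ℂ[X] V, ∀ m, B m = v m := by
  have hgr' : gr = fun m => Submodule.span ℂ[X] {v m} := funext fun m => (hv m).1
  have hli : LinearIndependent ℂ[X] v := by
    refine Ideal.iSupIndep.linearIndependent' ?_ fun m => ?_
    · have := hgr.submodule_iSupIndep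
      rwa [hgr'] at this
    · refine (Submodule.eq_bot_iff _).2 fun p hp => (hv m).2 p ?_
      simpa using hp
  have htop : ⊤ ≤ Submodule.span ℂ[X] (Set.range v) := by
    rw [Submodule.span_range_eq_iSup, ← hgr.submodule_iSup_eq_top, hgr']
  exact ⟨Module.Basis.mk hli htop, fun m => by simp⟩

end Generators

/-! ### Sesquilinear maps are determined on bases -/

section SesquilinearMaps

variable {R : Type*} [AddCommGroup R] [Module ℂ R] [Module ℂ[X] R]
variable {V : Type*} [AddCommGroup V] [Module ℂ V] [Module ℂ[X] V]
variable {W : Type*} [AddCommGroup W] [Module ℂ W] [Module ℂ[X] W] [IsScalarTower ℂ ℂ[X] W]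

/-- Conformal sesquilinearity of a `ℂ`-bilinear map with values in `W[λ]`. -/
structure IsSesquilinear (S : R →ₗ[ℂ] V →ₗ[ℂ] LamPoly W) : Prop where
  left : ∀ (a : R) (v : V), S ((X : ℂ[X]) • a) v = (-X : ℂ[X][X]) • S a v
  right : ∀ (a : R) (v : V), S a ((X : ℂ[X]) • v) = (C X + X : ℂ[X][X]) • S a v

namespace IsSesquilinear

variable {S T : R →ₗ[ℂ] V →ₗ[ℂ] LamPoly W}

theorem smul_left [IsScalarTower ℂ ℂ[X] R] (hS : IsSesquilinear S) (p : ℂ[X]) (a : R) (v : V) :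
    S (p • a) v = aeval (-X : ℂ[X][X]) p • S a v := by
  induction p using Polynomial.induction_on generalizing a with
  | C c =>
    rw [C_smul_eq, map_smul, LinearMap.smul_apply, aeval_C, algebraMap_smul]
  | add p q hp hq => simp only [add_smul, map_add, LinearMap.add_apply, hp, hq]
  | monomial n c h =>
    rw [show (C c * X ^ (n + 1) : ℂ[X]) = (C c * X ^ n) * X by ring, mul_smul, h, hS.left,
      map_mul _ (C c * X ^ n) X, aeval_X, mul_smul]

theorem smul_right [IsScalarTower ℂ ℂ[X] V] (hS : IsSesquilinear S) (p : ℂ[X]) (a : R) (v : V) :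
    S a (p • v) = aeval (C X + X : ℂ[X][X]) p • S a v := by
  induction p using Polynomial.induction_on generalizing v with
  | C c => rw [C_smul_eq, map_smul, aeval_C, algebraMap_smul]
  | add p q hp hq => simp only [add_smul, map_add, hp, hq]
  | monomial n c h =>
    rw [show (C c * X ^ (n + 1) : ℂ[X]) = (C c * X ^ n) * X by ring, mul_smul, h, hS.right,
      map_mul _ (C c * X ^ n) X, aeval_X, mul_smul]

theorem ext_basis [IsScalarTower ℂ ℂ[X] R] [IsScalarTower ℂ ℂ[X] V]
    (hS : IsSesquilinear S) (hT : IsSesquilinear T) {ι κ : Type*}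
    (A : Module.Basis ι ℂ[X] R) (B : Module.Basis κ ℂ[X] V)
    (h : ∀ i j, S (A i) (B j) = T (A i) (B j)) : S = T := by
  refine LinearMap.ext₂ fun a v => ?_
  induction A.mem_span a using Submodule.span_induction with
  | mem a ha =>
    obtain ⟨i, rfl⟩ := ha
    induction B.mem_span v using Submodule.span_induction with
    | mem v hv => obtain ⟨j, rfl⟩ := hv; exact h i j
    | zero => simp
    | add v w _ _ hv hw => rw [map_add, map_add, hv, hw]
    | smul p v _ hv => rw [hS.smul_right, hT.smul_right, hv]
  | zero => simp
  | add a b _ _ ha hb => simp only [map_add, LinearMap.add_apply, ha, hb]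
  | smul p a _ ha => rw [hS.smul_left, hT.smul_left, ha]

end IsSesquilinear

theorem isSesquilinear_sesqExtend {ι κ : Type*} (K : ι → κ → LamPoly (κ →₀ ℂ[X])) :
    IsSesquilinear (sesqExtend K) :=
  ⟨sesqExtend_left K, sesqExtend_right K⟩

end SesquilinearMaps

/-! ### From conformal modules to coefficients and back -/

/-- The degree of a generator of `CHV(a,b)`. -/
def CHVGen.deg : CHVGen → ℤ
  | .L i => i
  | .M i => i

theorem single_mem_chvGrading (x : CHVGen) :
    (Finsupp.single x 1 : CHVCarrier) ∈ chvGrading x.deg := by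
  cases x <;> exact Submodule.subset_span (by simp [CHVGen.deg])

theorem evalEval_aeval_add (p : ℂ[X]) (x l : ℂ) :
    evalEval x l (aeval (C X + X : ℂ[X][X]) p) = p.eval (x + l) := by
  induction p using Polynomial.induction_on' with
  | add p q hp hq => rw [map_add, evalEval_add, hp, hq, eval_add]
  | monomial n c => simp [aeval_monomial, evalEval]

theorem evalEval_aeval_neg (p : ℂ[X]) (x l : ℂ) :
    evalEval x l (aeval (-X : ℂ[X][X]) p) = p.eval (-l) := by
  induction p using Polynomial.induction_on' with
  | add p q hp hq => rw [map_add, evalEval_add, hp, hq, eval_add]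
  | monomial n c => simp [aeval_monomial, evalEval]

section Coefficients

variable {V : Type*} [AddCommGroup V] [Module ℂ V] [Module ℂ[X] V]
variable {act : CHVCarrier →ₗ[ℂ] V →ₗ[ℂ] LamPoly V} {gr : ℤ → Submodule ℂ[X] V} {v : ℤ → V}

/-- `x _λ v_m = K x m (∂, λ) v_{deg x + m}` for the generators `x` of `CHV(a,b)`. -/
def HasCoefficients (act : CHVCarrier →ₗ[ℂ] V →ₗ[ℂ] LamPoly V) (v : ℤ → V)
    (K : CHVGen → ℤ → ℂ[X][X]) : Prop :=
  ∀ x m, act (Finsupp.single x 1) (v m) =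
    K x m • PolynomialModule.single ℂ[X] 0 (v (x.deg + m))

theorem IsFreeIntermediateSeries.exists_hasCoefficients
    (hgr : IsFreeIntermediateSeries chvGrading act gr) (hv : IsGenerating gr v) :
    ∃ K, HasCoefficients act v K := by
  have h : ∀ x m, ∃ F : ℂ[X][X], act (Finsupp.single x 1) (v m) =
      F • PolynomialModule.single ℂ[X] 0 (v (x.deg + m)) := fun x m => by
    refine exists_eq_smul_single _ fun n => ?_
    rw [← (hv _).1]
    refine hgr.act_mem _ _ _ (single_mem_chvGrading x) _ ?_ n
    rw [(hv m).1]
    exact Submodule.mem_span_singleton_self _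
  choose K hK using h
  exact ⟨K, hK⟩

variable [IsScalarTower ℂ ℂ[X] V] {a b : ℂ} {K : CHVGen → ℤ → ℂ[X][X]}

/-- The module identity on generators, in terms of coefficients. -/
theorem HasCoefficients.relation (hK : HasCoefficients act v K)
    (hmod : IsConformalModule (CHV a b) act) (hv : IsGenerating gr v) {x y z : CHVGen}
    {P : ℂ[X][X]}
    (hP : chvBasisBracket a b x y = P • PolynomialModule.single ℂ[X] 0 (Finsupp.single z 1))
    (hz : z.deg = x.deg + y.deg) (m : ℤ) (w s t : ℂ) :
    evalEval (w + s) t (K y m) * evalEval w s (K x (y.deg + m)) -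
      evalEval (w + t) s (K x m) * evalEval w t (K y (x.deg + m)) =
    evalEval (-(s + t)) s P * evalEval w (s + t) (K z m) := by
  have hs : IsSesquilinear act := ⟨hmod.act_left, hmod.act_right⟩
  have h := hmod.act_br (Finsupp.single x 1) (Finsupp.single y 1) (v m) s t
  have hbr : atLam s ((CHV a b).br (Finsupp.single x 1) (Finsupp.single y 1)) =
      P.eval (C s) • (Finsupp.single z 1 : CHVCarrier) := by
    change atLam s (sesqExtend (chvBasisBracket a b) _ _) = _
    rw [sesqExtend_single, hP, map_one, map_one, mul_one, one_smul, atLam_smul_single]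
  rw [hbr, hK, hK, atLam_smul_single, atLam_smul_single, hs.smul_right, hs.smul_right,
    hs.smul_left, hK, hK, hK, smul_smul, smul_smul, smul_smul, atLam_smul_single,
    atLam_smul_single, atLam_smul_single, add_left_comm y.deg, ← add_assoc, hz, ← sub_smul] at h
  -- Both sides are multiples of one free generator, so their coefficients agree.
  have h1 := sub_eq_zero.1 ((hv _).2 _ ((sub_smul _ _ _).trans (sub_eq_zero.2 h)))
  have h2 := congrArg (eval w) h1
  simp only [eval_sub, eval_mul] at h2
  have e1 : ∀ (p : ℂ[X]) (u : ℂ), eval w (eval (C u) (aeval (C X + X : ℂ[X][X]) p)) =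
      p.eval (w + u) := fun p u => evalEval_aeval_add p w u
  have e2 : ∀ p : ℂ[X], eval w (eval (C (s + t)) (aeval (-X : ℂ[X][X]) p)) =
      p.eval (-(s + t)) := fun p => evalEval_aeval_neg p w _
  rw [e1, e1, e2] at h2
  exact h2

theorem HasCoefficients.isLoopVirasoro (hK : HasCoefficients act v K)
    (hmod : IsConformalModule (CHV a b) act) (hv : IsGenerating gr v) :
    IsLoopVirasoro fun i m => K (.L i) m := by
  intro i j m x s t
  refine (hK.relation hmod hv (x := .L i) (y := .L j) (z := .L (i + j)) rfl rfl m x s t).trans ?_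
  congr 1
  simp [evalEval]
  ring

theorem HasCoefficients.isLoopExtension (hK : HasCoefficients act v K)
    (hmod : IsConformalModule (CHV a b) act) (hv : IsGenerating gr v) :
    IsLoopExtension a b (fun i m => K (.L i) m) fun i m => K (.M i) m where
  lm i j m x s t := by
    refine (hK.relation hmod hv (x := .L i) (y := .M j) (z := .M (i + j)) rfl rfl m x s t).trans ?_
    congr 1
    simp [evalEval_add, evalEval_mul, evalEval_C]
    ring
  mm i j m x s t := by
    have h := hK.relation hmod hv (x := .M i) (y := .M j) (z := .M (i + j)) (P := 0)
      (zero_smul _ _).symm rfl m x s t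
    rw [evalEval_zero, zero_mul] at h
    exact sub_eq_zero.1 h

/-- The coordinate map of the basis `v` is the isomorphism. Acting before or after it gives two
sesquilinear maps, which need comparing on generators only. -/
theorem HasCoefficients.gradedIsomorphic (hK : HasCoefficients act v K)
    (hmod : IsConformalModule (CHV a b) act) (hv : IsGenerating gr v)
    (hgr : DirectSum.IsInternal gr) {f : ℤ → ℤ → ℂ[X][X]} {d : ℂ}
    (hL : ∀ i m, K (.L i) m = f i m) (hM : ∀ i m, K (.M i) m = C (C d)) :
    GradedIsomorphic act gr (seriesAct f d) seriesGrading := by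
  obtain ⟨B, hB⟩ := hv.exists_basis hgr
  have hs : IsSesquilinear act := ⟨hmod.act_left, hmod.act_right⟩
  let φ : V →ₗ[ℂ[X]] SeriesCarrier := B.repr
  have hφ : ∀ m, φ (v m) = Finsupp.single m 1 := fun m => by
    rw [← hB]; exact B.repr_self m
  have hss : IsSesquilinear (seriesAct f d) := isSesquilinear_sesqExtend _
  let S : CHVCarrier →ₗ[ℂ] V →ₗ[ℂ] LamPoly SeriesCarrier :=
    (seriesAct f d).compl₂ (φ.restrictScalars ℂ)
  let T : CHVCarrier →ₗ[ℂ] V →ₗ[ℂ] LamPoly SeriesCarrier :=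
    act.compr₂ ((PolynomialModule.map ℂ[X] φ).restrictScalars ℂ)
  have hS : IsSesquilinear S :=
    ⟨fun a v => hss.left a (φ v), fun a v =>
      (congrArg (seriesAct f d a) (map_smul φ X v)).trans (hss.right a (φ v))⟩
  have hT : IsSesquilinear T :=
    ⟨fun a v => (congrArg (PolynomialModule.map ℂ[X] φ) (hs.left a v)).trans
      (map_lamPoly_smul _ _ _), fun a v =>
      (congrArg (PolynomialModule.map ℂ[X] φ) (hs.right a v)).trans (map_lamPoly_smul _ _ _)⟩
  have hST : S = T := by
    refine hS.ext_basis hT Finsupp.basisSingleOne B fun x m => ?_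
    change seriesAct f d (Finsupp.basisSingleOne x) (φ (B m)) =
      PolynomialModule.map ℂ[X] φ (act (Finsupp.basisSingleOne x) (B m))
    rw [Finsupp.coe_basisSingleOne, hB, hφ, hK, map_lamPoly_smul, PolynomialModule.map_single, hφ,
      seriesAct, sesqExtend_single, map_one, map_one, mul_one, one_smul]
    cases x with
    | L i => rw [hL]; rfl
    | M i => rw [hM]; rfl
  refine ⟨B.repr, fun a v => LinearMap.congr_fun₂ hST a v, fun m => ?_⟩
  rw [(hv m).1, Submodule.map_span, Set.image_singleton]
  change Submodule.span _ {φ (v m)} = _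
  rw [hφ, seriesGrading]

/-- If all `L_i` act by zero, the relation of `L_0` with `M_i` at `s = 0` makes `M_i` act by zero
too, so the whole action vanishes. -/
theorem HasCoefficients.exists_ne_zero (hK : HasCoefficients act v K)
    (hmod : IsConformalModule (CHV a b) act) (hv : IsGenerating gr v)
    (hgr : DirectSum.IsInternal gr) (hne : act ≠ 0) : ∃ i m, K (.L i) m ≠ 0 := by
  by_contra! hL
  have hM : ∀ i m, K (.M i) m = 0 := fun i m => by
    refine eq_zero_of_forall_sub_mul (b := b) fun x t => ?_
    have := (hK.isLoopExtension hmod hv).lm 0 i m x 0 t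
    simp only [hL, evalEval_zero, zero_add] at this
    linear_combination -this
  obtain ⟨B, hB⟩ := hv.exists_basis hgr
  refine hne (IsSesquilinear.ext_basis ⟨hmod.act_left, hmod.act_right⟩
    ⟨fun _ _ => by simp, fun _ _ => by simp⟩ Finsupp.basisSingleOne B fun x m => ?_)
  rw [Finsupp.coe_basisSingleOne, hB, hK]
  cases x with
  | L i => rw [hL]; simp
  | M i => rw [hM]; simp

/-- Change of generators that normalizes the coefficients of the `L_i`. -/
theorem HasCoefficients.rescale (hK : HasCoefficients act v K)
    (hmod : IsConformalModule (CHV a b) act) (hv : IsGenerating gr v)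
    (hgr : IsFreeIntermediateSeries chvGrading act gr) {c : ℤ → ℂ} (hc : ∀ m, c m ≠ 0)
    {F : ℤ → ℤ → ℂ[X][X]} (hF : ∀ i m, C (C (c m)) * K (.L i) m = C (C (c (i + m))) * F i m) :
    ∃ K', HasCoefficients act (fun m => (C (c m) : ℂ[X]) • v m) K' ∧
      ∀ i m, K' (.L i) m = F i m := by
  obtain ⟨K', hK'⟩ := hgr.exists_hasCoefficients (hv.rescale hc)
  refine ⟨K', hK', fun i m => smul_single_injective (hv.rescale hc (i + m)).2 ?_⟩
  have hs : IsSesquilinear act := ⟨hmod.act_left, hmod.act_right⟩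
  have hsm : ∀ (r : ℂ) (w : V), PolynomialModule.single ℂ[X] 0 ((C r : ℂ[X]) • w) =
      (C (C r) : ℂ[X][X]) • PolynomialModule.single ℂ[X] 0 w := fun r w => by
    rw [← monomial_zero_left (a := C r), PolynomialModule.monomial_smul_single, zero_add]
  have h := hK' (.L i) m
  rw [hs.smul_right, hK, aeval_C, smul_smul] at h
  change (C (C (c m)) * K (.L i) m) • _ = K' (.L i) m • PolynomialModule.single ℂ[X] 0
    ((C (c (i + m)) : ℂ[X]) • v (i + m)) at h
  rw [← h, hF, hsm, smul_smul, mul_comm]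
  rfl

end Coefficients

/-! ### The classification theorem -/

theorem mainTheorem6 (a b : ℂ) {V : Type*} [AddCommGroup V] [Module ℂ V] [Module ℂ[X] V]
    [IsScalarTower ℂ ℂ[X] V]
    (act : CHVCarrier →ₗ[ℂ] V →ₗ[ℂ] LamPoly V) (gr : ℤ → Submodule ℂ[X] V)
    (hmod : IsConformalModule (CHV a b) act)
    (hgr : IsFreeIntermediateSeries chvGrading act gr)
    (hnontrivial : act ≠ 0) :
    (a ≠ 1 ∨ b ≠ 0 →
      (∃ α β : ℂ, GradedIsomorphic act gr (firstAct α β 0) seriesGrading) ∨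
      ∃ (A : ℤ → Fin 2) (β : ℂ), GradedIsomorphic act gr (secondAct A β 0) seriesGrading) ∧
    (a = 1 ∧ b = 0 →
      (∃ α β d : ℂ, GradedIsomorphic act gr (firstAct α β d) seriesGrading) ∨
      ∃ (A : ℤ → Fin 2) (β d : ℂ),
        GradedIsomorphic act gr (secondAct A β d) seriesGrading) := by
  obtain ⟨v, hv⟩ : ∃ v, IsGenerating gr v := by
    choose v hv using hgr.free
    exact ⟨v, hv⟩
  obtain ⟨K, hK⟩ := hgr.exists_hasCoefficients hv
  obtain ⟨c, hc, ⟨α, β, hF⟩ | ⟨A, β, hA, hF⟩⟩ := (hK.isLoopVirasoro hmod hv).classification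
    (hK.exists_ne_zero hmod hv hgr.isInternal hnontrivial)
  · obtain ⟨K', hK', hL⟩ := hK.rescale hmod hv hgr hc hF
    have hext := hK'.isLoopExtension hmod (hv.rescale hc)
    simp only [hL] at hext
    obtain ⟨d, hd, hd0⟩ := hext.first
    have hiso : GradedIsomorphic act gr (firstAct α β d) seriesGrading :=
      hK'.gradedIsomorphic hmod (hv.rescale hc) hgr.isInternal hL hd
    refine ⟨fun h => Or.inl ⟨α, β, ?_⟩, fun _ => Or.inl ⟨α, β, d, hiso⟩⟩
    rwa [hd0 h] at hiso
  · obtain ⟨K', hK', hL⟩ := hK.rescale hmod hv hgr hc hF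
    have hext := hK'.isLoopExtension hmod (hv.rescale hc)
    simp only [hL] at hext
    have hiso : GradedIsomorphic act gr (secondAct A β 0) seriesGrading :=
      hK'.gradedIsomorphic hmod (hv.rescale hc) hgr.isInternal hL fun i m => by
        rw [hext.second hA, C_0, C_0]
    exact ⟨fun _ => Or.inr ⟨A, β, hiso⟩, fun _ => Or.inr ⟨A, β, 0, hiso⟩⟩
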